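/- Let $0\le p<n$ and $m\ge 0$ be integers, let $\mathbf Z\in\mathbb R^{n\times p}$ with $\mathbf Z^\intercal\mathbf Z$ invertible, $\mathbf H=\mathbf Z(\mathbf Z^\intercal\mathbf Z)^{-1}\mathbf Z^\intercal$, let $\mathbf X\in\mathbb R^{n\times m}$, and let $\boldsymbol\Sigma$ be a diagonal $n\times n$ matrix with non-negative diagonal entries. Put $F=\{1,\dots,m\}$. For $S\subseteq F$ let $\mathbf X_S$ be the submatrix of the columns of $\mathbf X$ indexed by $S$, let $\boldsymbol\lambda_S=(\lambda_1^S,\dots,\lambda_n^S)$ be the eigenvalues, with multiplicity and in descending order, of $$\boldsymbol\Sigma^{1/2}(\mathbf I-\mathbf H)\mathbf X_S\mathbf X_S^\intercal(\mathbf I-\mathbf H)\boldsymbol\Sigma^{1/2},$$ and let $\ell_S=\sum_{i=1}^n\lambda_i^S$. For $\alpha\in(0,1)$ and a vector $\boldsymbol\lambda\in\mathbb R^n$ let $c(\boldsymbol\lambda)$ be the $1-\alpha$ quantile $\inf\{t: P(\sum_{i=1}^n\lambda_i\xi_i\le t)\ge 1-\alpha\}$, where $\xi_1,\dots,\xi_n$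 are independent $\chi^2_1$ variables, and write $c_S=c(\boldsymbol\lambda_S)$. Fix $R\subseteq F$. Then for every $S$ with $R\subseteq S\subseteq F$ there is exactly one vector of the form $$\hat{\boldsymbol\lambda}(\ell_S)=(\lambda_1^F,\dots,\lambda_i^F,\eta,\lambda_{i+2}^R,\dots,\lambda_n^R),\qquad 0\le i\le n-1,\quad \lambda_{i+1}^R\le\eta\le\lambda_{i+1}^F,$$ that is in descending order and has sum $\ell_S$. With $c_{\max}(\ell_S)=c(\hat{\boldsymbol\lambda}(\ell_S))$, there is an $\alpha_0\in(0,1)$ such that for all $\alpha$ with $0<\alpha\le\alpha_0$ and all $S$ with $R\subseteq S\subseteq F$, $$c_S\le c_{\max}(\ell_S).$$ -/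

import Mathlib

/-- The eigenvalues of a real symmetric `n × n` matrix, with multiplicity, in descending order. -/
noncomputable def sortedEigenvalues {n : ℕ} {A : Matrix (Fin n) (Fin n) ℝ}
    (hA : A.IsHermitian) : Fin n → ℝ :=
  fun i => hA.eigenvalues₀ (Fin.cast (Fintype.card_fin n).symm i)

theorem sortedEigenvalues_antitone {n : ℕ} {A : Matrix (Fin n) (Fin n) ℝ}
    (hA : A.IsHermitian) : Antitone (sortedEigenvalues hA) :=
  fun _ _ h => hA.eigenvalues₀_antitone h

/-- The hat matrix `H = Z (Zᵀ Z)⁻¹ Zᵀ` of the confounders. -/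
noncomputable def hatMatrix {n p : ℕ} (Z : Matrix (Fin n) (Fin p) ℝ) :
    Matrix (Fin n) (Fin n) ℝ :=
  Z * (Z.transpose * Z)⁻¹ * Z.transpose

/-- The design matrix `X_S` consisting of the columns of `X` with index in `S`. -/
def subDesign {n m : ℕ} (X : Matrix (Fin n) (Fin m) ℝ) (S : Finset (Fin m)) :
    Matrix (Fin n) S ℝ :=
  X.submatrix id (fun j => (j : Fin m))

/-- `Σ^{1/2} (I - H) X_S X_Sᵀ (I - H) Σ^{1/2}`, where `Σ` is the diagonal covariance matrix with
diagonal `σ`. -/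
noncomputable def nullMatrix {n p m : ℕ} (Z : Matrix (Fin n) (Fin p) ℝ)
    (X : Matrix (Fin n) (Fin m) ℝ) (σ : Fin n → ℝ) (S : Finset (Fin m)) :
    Matrix (Fin n) (Fin n) ℝ :=
  Matrix.diagonal (fun i => Real.sqrt (σ i)) * (1 - hatMatrix Z) *
    (subDesign X S * (subDesign X S).transpose) *
    (1 - hatMatrix Z) * Matrix.diagonal (fun i => Real.sqrt (σ i))

theorem hatMatrix_transpose {n p : ℕ} (Z : Matrix (Fin n) (Fin p) ℝ) :
    (hatMatrix Z).transpose = hatMatrix Z := by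
  simp [hatMatrix, Matrix.transpose_mul, Matrix.transpose_nonsing_inv, Matrix.mul_assoc]

theorem nullMatrix_isHermitian {n p m : ℕ} (Z : Matrix (Fin n) (Fin p) ℝ)
    (X : Matrix (Fin n) (Fin m) ℝ) (σ : Fin n → ℝ) (S : Finset (Fin m)) :
    (nullMatrix Z X σ S).IsHermitian := by
  unfold Matrix.IsHermitian
  rw [Matrix.conjTranspose_eq_transpose_of_trivial]
  simp [nullMatrix, Matrix.transpose_mul, hatMatrix_transpose, Matrix.mul_assoc]

/-- The vector `λ_S` of weights of the null distribution for the feature set `S`: the eigenvalues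
of the matrix above in descending order. -/
noncomputable def nullWeights {n p m : ℕ} (Z : Matrix (Fin n) (Fin p) ℝ)
    (X : Matrix (Fin n) (Fin m) ℝ) (σ : Fin n → ℝ) (S : Finset (Fin m)) : Fin n → ℝ :=
  sortedEigenvalues (nullMatrix_isHermitian Z X σ S)

/-- The level `ℓ_S = ∑ i, λ_i^S` of the feature set `S`. -/
noncomputable def level {n p m : ℕ} (Z : Matrix (Fin n) (Fin p) ℝ)
    (X : Matrix (Fin n) (Fin m) ℝ) (σ : Fin n → ℝ) (S : Finset (Fin m)) : ℝ :=
  ∑ i, nullWeights Z X σ S i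

/-- The law of `∑ i, w i * χ²₁` with independent `χ²₁` variables, which are the squares of
independent standard normal variables. -/
noncomputable def weightedChiSq {n : ℕ} (w : Fin n → ℝ) : MeasureTheory.Measure ℝ :=
  (MeasureTheory.Measure.pi (fun _ : Fin n => ProbabilityTheory.gaussianReal 0 1)).map
    (fun z => ∑ i, w i * z i ^ 2)

/-- The critical value `c(w)` at significance level `α`: the `1 - α` quantile of the law of
`∑ i, w i * χ²₁`. -/
noncomputable def critValue (α : ℝ) {n : ℕ} (w : Fin n → ℝ) : ℝ :=
  sInf {t : ℝ | 1 - α ≤ (weightedChiSq w).real (Set.Iic t)}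

/-- `v` is the majorizing vector at level `ℓ` between the lower bound `lo` and the upper bound
`up`, both in descending order: a head of `up`, one connecting entry `η` between the bounds, and a
tail of `lo`, in descending order and with sum `ℓ`. -/
def IsMajorizingVector {n : ℕ} (up lo : Fin n → ℝ) (ℓ : ℝ) (v : Fin n → ℝ) : Prop :=
  ∃ (i : Fin n) (η : ℝ),
    (∀ j, j < i → v j = up j) ∧ v i = η ∧ (∀ j, i < j → v j = lo j) ∧
    lo i ≤ η ∧ η ≤ up i ∧ Antitone v ∧ ∑ j, v j = ℓ

/-!
By Weyl monotonicity the weights `w` of `S` lie between those of `R` and those of the full set, so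
the majorizing vector `v` at level `∑ w` is a mean-preserving spread of `w`: above some threshold
its entries are larger, below it they are smaller. Let `μ` be the largest entry of `v`, and assume
`v ≠ w`. If all entries of `w` are smaller than `μ`, the tail of `∑ w ξ` decays faster than that of
`μ ξ`. Otherwise the entries of `w` equal to `μ` are also entries of `v`, at the same indices. This
common block contributes a gamma variable whose tail is asymptotically exponential with rate
`1 / (2 μ)`, and adding an independent variable `Y` of lighter tail multiplies such a tail
asymptotically by `E exp (Y / (2 μ))`. For the remaining weights this factor is
`∏ (1 - w j / μ) ^ (-1 / 2)`, which is strictly larger, possibly infinite, for the spread `v`.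
Hence far out the tail of `∑ v ξ` dominates that of `∑ w ξ`, and so do its high quantiles.
Finitely many `S` are compared, so one significance level serves for all of them.
-/

section EigenvalueMonotonicity

open Module Matrix RCLike

variable {𝕜 E : Type*} [RCLike 𝕜] [NormedAddCommGroup E] [InnerProductSpace 𝕜 E]
  {n : ℕ}

lemma exists_ne_zero_inner_eq_zero (a b : OrthonormalBasis (Fin n) 𝕜 E) (i : Fin n) :
    ∃ x ≠ 0, (∀ j, i < j → inner 𝕜 (a j) x = 0) ∧ ∀ j, j < i → inner 𝕜 (b j) x = 0 := by
  have := a.toBasis.finiteDimensional_of_finite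
  let f : E →ₗ[𝕜] ({j : Fin n // j ≠ i} → 𝕜) := LinearMap.pi fun j =>
    if j.1 < i then innerₛₗ 𝕜 (b j) else innerₛₗ 𝕜 (a j)
  have hlt : finrank 𝕜 ({j : Fin n // j ≠ i} → 𝕜) < finrank 𝕜 E := by
    rw [finrank_fintype_fun_eq_card, finrank_eq_card_basis a.toBasis]
    exact Fintype.card_subtype_lt (p := fun j : Fin n => j ≠ i) (x := i) (by simp)
  obtain ⟨x, hx, hx0⟩ := (Submodule.ne_bot_iff _).1 (f.ker_ne_bot_of_finrank_lt hlt)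
  have hfx (j : {j : Fin n // j ≠ i}) : f x j = 0 := congrFun (LinearMap.mem_ker.1 hx) j
  refine ⟨x, hx0, fun j hj => ?_, fun j hj => ?_⟩
  · simpa [f, hj.not_gt] using hfx ⟨j, hj.ne'⟩
  · simpa [f, hj] using hfx ⟨j, hj.ne⟩

variable [FiniteDimensional 𝕜 E] {T U : E →ₗ[𝕜] E}

lemma re_inner_apply_self_eq_sum_eigenvalues (hT : T.IsSymmetric) (hn : finrank 𝕜 E = n) (x : E) :
    re (inner 𝕜 (T x) x)
      = ∑ j, hT.eigenvalues hn j * ‖inner 𝕜 (hT.eigenvectorBasis hn j) x‖ ^ 2 := by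
  rw [← (hT.eigenvectorBasis hn).sum_inner_mul_inner (T x) x, map_sum]
  refine Finset.sum_congr rfl fun j _ => ?_
  rw [hT x, hT.apply_eigenvectorBasis hn j, inner_smul_right, mul_assoc, re_ofReal_mul,
    inner_mul_symm_re_eq_norm, norm_mul, norm_inner_symm, ← sq]

lemma eigenvalues_mul_norm_sq_le_re_inner (hT : T.IsSymmetric) (hn : finrank 𝕜 E = n) {i : Fin n}
    {x : E} (hx : ∀ j, i < j → inner 𝕜 (hT.eigenvectorBasis hn j) x = 0) :
    hT.eigenvalues hn i * ‖x‖ ^ 2 ≤ re (inner 𝕜 (T x) x) := by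
  rw [re_inner_apply_self_eq_sum_eigenvalues hT hn,
    ← (hT.eigenvectorBasis hn).sum_sq_norm_inner_right, Finset.mul_sum]
  refine Finset.sum_le_sum fun j _ => ?_
  rcases le_or_gt j i with hj | hj
  · exact mul_le_mul_of_nonneg_right (hT.eigenvalues_antitone hn hj) (sq_nonneg _)
  · simp [hx j hj]

lemma re_inner_le_eigenvalues_mul_norm_sq (hT : T.IsSymmetric) (hn : finrank 𝕜 E = n) {i : Fin n}
    {x : E} (hx : ∀ j, j < i → inner 𝕜 (hT.eigenvectorBasis hn j) x = 0) :
    re (inner 𝕜 (T x) x) ≤ hT.eigenvalues hn i * ‖x‖ ^ 2 := by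
  rw [re_inner_apply_self_eq_sum_eigenvalues hT hn,
    ← (hT.eigenvectorBasis hn).sum_sq_norm_inner_right, Finset.mul_sum]
  refine Finset.sum_le_sum fun j _ => ?_
  rcases le_or_gt i j with hj | hj
  · exact mul_le_mul_of_nonneg_right (hT.eigenvalues_antitone hn hj) (sq_nonneg _)
  · simp [hx j hj]

lemma eigenvalues_le_eigenvalues (hT : T.IsSymmetric) (hU : U.IsSymmetric) (hn : finrank 𝕜 E = n)
    (h : ∀ x, re (inner 𝕜 (T x) x) ≤ re (inner 𝕜 (U x) x)) (i : Fin n) :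
    hT.eigenvalues hn i ≤ hU.eigenvalues hn i := by
  obtain ⟨x, hx0, hxT, hxU⟩ :=
    exists_ne_zero_inner_eq_zero (hT.eigenvectorBasis hn) (hU.eigenvectorBasis hn) i
  have hx : 0 < ‖x‖ ^ 2 := by positivity
  refine le_of_mul_le_mul_right ?_ hx
  calc hT.eigenvalues hn i * ‖x‖ ^ 2
      ≤ re (inner 𝕜 (T x) x) := eigenvalues_mul_norm_sq_le_re_inner hT hn hxT
    _ ≤ re (inner 𝕜 (U x) x) := h x
    _ ≤ hU.eigenvalues hn i * ‖x‖ ^ 2 := re_inner_le_eigenvalues_mul_norm_sq hU hn hxU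

lemma sortedEigenvalues_le_of_posSemidef_sub {A B : Matrix (Fin n) (Fin n) ℝ}
    (hA : A.IsHermitian) (hB : B.IsHermitian) (h : (B - A).PosSemidef) :
    sortedEigenvalues hA ≤ sortedEigenvalues hB := by
  refine fun i => eigenvalues_le_eigenvalues _ _ _ (fun x => ?_) _
  have := h.dotProduct_mulVec_nonneg (WithLp.ofLp x)
  simpa [EuclideanSpace.inner_eq_star_dotProduct, toEuclideanLin, sub_mulVec] using this

lemma sortedEigenvalues_nonneg {A : Matrix (Fin n) (Fin n) ℝ} (hA : A.PosSemidef) :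
    0 ≤ sortedEigenvalues hA.isHermitian := fun i => by
  have h := hA.eigenvalues_nonneg
    (Fintype.equivOfCardEq (Fintype.card_fin _) (Fin.cast (Fintype.card_fin n).symm i))
  simpa [IsHermitian.eigenvalues, sortedEigenvalues] using h

end EigenvalueMonotonicity

section NullWeights

open Matrix

variable {n p m : ℕ} (Z : Matrix (Fin n) (Fin p) ℝ) (X : Matrix (Fin n) (Fin m) ℝ)
  (σ : Fin n → ℝ)

lemma nullMatrix_posSemidef (S : Finset (Fin m)) : (nullMatrix Z X σ S).PosSemidef := by
  have h : nullMatrix Z X σ S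
      = diagonal (fun i => √(σ i)) * (1 - hatMatrix Z) * subDesign X S
        * (diagonal (fun i => √(σ i)) * (1 - hatMatrix Z) * subDesign X S)ᴴ := by
    simp [nullMatrix, conjTranspose_eq_transpose_of_trivial, transpose_mul, hatMatrix_transpose,
      Matrix.mul_assoc]
  exact h ▸ posSemidef_self_mul_conjTranspose _

lemma subDesign_mul_transpose_sdiff {S T : Finset (Fin m)} (hST : S ⊆ T) :
    subDesign X (T \ S) * (subDesign X (T \ S))ᵀ
      = subDesign X T * (subDesign X T)ᵀ - subDesign X S * (subDesign X S)ᵀ := by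
  have entry (V : Finset (Fin m)) (a b : Fin n) :
      (subDesign X V * (subDesign X V)ᵀ) a b = ∑ j ∈ V, X a j * X b j := by
    simp only [subDesign, mul_apply, transpose_apply, submatrix_apply, id_eq]
    exact Finset.sum_coe_sort V fun j => X a j * X b j
  ext a b
  rw [Matrix.sub_apply, entry, entry, entry, Finset.sum_sdiff_eq_sub hST]

lemma nullMatrix_sdiff {S T : Finset (Fin m)} (hST : S ⊆ T) :
    nullMatrix Z X σ (T \ S) = nullMatrix Z X σ T - nullMatrix Z X σ S := by
  rw [nullMatrix, nullMatrix, nullMatrix, subDesign_mul_transpose_sdiff X hST, ← Matrix.sub_mul,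
    ← Matrix.sub_mul, ← Matrix.mul_sub]

lemma nullWeights_mono : Monotone (nullWeights Z X σ) := fun S T hST =>
  sortedEigenvalues_le_of_posSemidef_sub _ _
    (nullMatrix_sdiff Z X σ hST ▸ nullMatrix_posSemidef Z X σ (T \ S))

lemma nullWeights_nonneg (S : Finset (Fin m)) : 0 ≤ nullWeights Z X σ S :=
  sortedEigenvalues_nonneg (nullMatrix_posSemidef Z X σ S)

lemma nullWeights_antitone (S : Finset (Fin m)) : Antitone (nullWeights Z X σ S) :=
  sortedEigenvalues_antitone _

lemma level_mono : Monotone (level Z X σ) := fun _ _ hST =>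
  Finset.sum_le_sum fun i _ => nullWeights_mono Z X σ hST i

end NullWeights

section MajorizingVector

variable {n : ℕ} {up lo v w : Fin n → ℝ} {ℓ : ℝ}

lemma le_and_le_of_head_tail {i : Fin n} (hle : lo ≤ up) (head : ∀ j, j < i → v j = up j)
    (tail : ∀ j, i < j → v j = lo j) (hlo : lo i ≤ v i) (hup : v i ≤ up i) :
    lo ≤ v ∧ v ≤ up := by
  refine ⟨fun j => ?_, fun j => ?_⟩ <;> rcases lt_trichotomy j i with h | rfl | h
  · exact (head j h).symm ▸ hle j
  · exact hlo
  · exact (tail j h).ge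
  · exact (head j h).le
  · exact hup
  · exact (tail j h).symm ▸ hle j

lemma antitone_of_head_tail {i : Fin n} (hup : Antitone up) (hlo : Antitone lo)
    (head : ∀ j, j < i → v j = up j) (tail : ∀ j, i < j → v j = lo j) (h1 : lo ≤ v)
    (h2 : v ≤ up) : Antitone v := by
  rw [antitone_iff_forall_lt]
  intro a b hab
  rcases le_or_gt b i with hb | hb
  · exact (h2 b).trans ((hup hab.le).trans (head a (hab.trans_le hb)).ge)
  · exact (tail b hb).le.trans ((hlo hab.le).trans (h1 a))

lemma IsMajorizingVector.nonneg (hv : IsMajorizingVector up lo ℓ v) (hlo : 0 ≤ lo)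
    (hle : lo ≤ up) : 0 ≤ v := by
  obtain ⟨i, η, head, rfl, tail, h1, h2, -⟩ := hv
  exact hlo.trans (le_and_le_of_head_tail hle head tail h1 h2).1

lemma IsMajorizingVector.sum_eq (hv : IsMajorizingVector up lo ℓ v) : ∑ j, v j = ℓ := by
  obtain ⟨-, -, -, -, -, -, -, -, h⟩ := hv
  exact h

lemma IsMajorizingVector.le_or_le {ℓ' : ℝ} (hle : lo ≤ up) (hv : IsMajorizingVector up lo ℓ v)
    (hw : IsMajorizingVector up lo ℓ' w) : v ≤ w ∨ w ≤ v := by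
  obtain ⟨i, η, vhead, rfl, vtail, hv1, hv2, -⟩ := hv
  obtain ⟨k, θ, whead, rfl, wtail, hw1, hw2, -⟩ := hw
  obtain ⟨lov, vup⟩ := le_and_le_of_head_tail hle vhead vtail hv1 hv2
  obtain ⟨low, wup⟩ := le_and_le_of_head_tail hle whead wtail hw1 hw2
  rcases lt_trichotomy i k with hik | rfl | hki
  · refine .inl fun j => ?_
    rcases lt_or_ge j k with hj | hj
    · exact (vup j).trans (whead j hj).ge
    · exact (vtail j (hik.trans_le hj)).le.trans (low j)
  · have hne (j : Fin n) (hj : j ≠ i) : v j = w j := by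
      rcases hj.lt_or_gt with h | h
      · rw [vhead j h, whead j h]
      · rw [vtail j h, wtail j h]
    refine (le_total (v i) (w i)).imp (fun h j => ?_) fun h j => ?_ <;>
      rcases eq_or_ne j i with rfl | hj
    exacts [h, (hne j hj).le, h, (hne j hj).ge]
  · refine .inr fun j => ?_
    rcases lt_or_ge j i with hj | hj
    · exact (wup j).trans (vhead j hj).ge
    · exact (wtail j (hki.trans_le hj)).le.trans (lov j)

lemma eq_of_le_of_sum_eq {ι : Type*} [Fintype ι] {x y : ι → ℝ} (h : x ≤ y)
    (hs : ∑ j, x j = ∑ j, y j) : x = y :=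
  funext fun j => (Finset.sum_eq_sum_iff_of_le fun j _ => h j).1 hs j (Finset.mem_univ j)

lemma IsMajorizingVector.unique (hle : lo ≤ up) (hv : IsMajorizingVector up lo ℓ v)
    (hw : IsMajorizingVector up lo ℓ w) : v = w := by
  have hs : ∑ j, v j = ∑ j, w j := hv.sum_eq.trans hw.sum_eq.symm
  rcases hv.le_or_le hle hw with h | h
  · exact eq_of_le_of_sum_eq h hs
  · exact (eq_of_le_of_sum_eq h hs.symm).symm

/-- The path from `lo` at `t = 0` to `up` at `t = n` that raises the entries to their upper bounds
one after the other, entry `j` during the time interval `[j, j + 1]`. -/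
noncomputable def fillingPath (up lo : Fin n → ℝ) (t : ℝ) (j : Fin n) : ℝ :=
  lo j + max 0 (min 1 (t - j)) * (up j - lo j)

lemma fillingPath_of_le {t : ℝ} {j : Fin n} (h : t ≤ j) : fillingPath up lo t j = lo j := by
  have : min 1 (t - j) ≤ 0 := (min_le_right _ _).trans (sub_nonpos.2 h)
  rw [fillingPath, max_eq_left this, zero_mul, add_zero]

lemma fillingPath_of_add_one_le {t : ℝ} {j : Fin n} (h : j + 1 ≤ t) :
    fillingPath up lo t j = up j := by
  rw [fillingPath, min_eq_left (by linarith), max_eq_right zero_le_one, one_mul,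
    add_sub_cancel]

lemma le_fillingPath (hle : lo ≤ up) (t : ℝ) : lo ≤ fillingPath up lo t := fun j =>
  le_add_of_nonneg_right (mul_nonneg (le_max_left _ _) (sub_nonneg.2 (hle j)))

lemma fillingPath_le (hle : lo ≤ up) (t : ℝ) : fillingPath up lo t ≤ up := fun j => by
  have : max 0 (min 1 (t - j)) ≤ 1 := max_le zero_le_one (min_le_left _ _)
  have := mul_le_of_le_one_left (sub_nonneg.2 (hle j)) this
  rw [fillingPath]
  linarith

lemma isMajorizingVector_fillingPath (hn : 0 < n) (hup : Antitone up) (hlo : Antitone lo)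
    (hle : lo ≤ up) {t : ℝ} (ht : 0 ≤ t) :
    IsMajorizingVector up lo (∑ j, fillingPath up lo t j) (fillingPath up lo t) := by
  let i : Fin n := ⟨min ⌊t⌋₊ (n - 1), by omega⟩
  have head (j : Fin n) (hj : j < i) : fillingPath up lo t j = up j := by
    have hjt : (j : ℕ) + 1 ≤ ⌊t⌋₊ := (lt_min_iff.1 (Fin.lt_def.1 hj)).1
    exact fillingPath_of_add_one_le (by exact_mod_cast (Nat.le_floor_iff ht).1 hjt)
  have tail (j : Fin n) (hj : i < j) : fillingPath up lo t j = lo j := by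
    have hjt : ⌊t⌋₊ < j := by
      have : min ⌊t⌋₊ (n - 1) < j := Fin.lt_def.1 hj
      omega
    exact fillingPath_of_le ((Nat.floor_lt ht).1 hjt).le
  exact ⟨i, _, head, rfl, tail, le_fillingPath hle t i, fillingPath_le hle t i,
    antitone_of_head_tail hup hlo head tail (le_fillingPath hle t) (fillingPath_le hle t), rfl⟩

lemma exists_isMajorizingVector (hn : 0 < n) (hup : Antitone up) (hlo : Antitone lo)
    (hle : lo ≤ up) (h1 : ∑ j, lo j ≤ ℓ) (h2 : ℓ ≤ ∑ j, up j) :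
    ∃ v, IsMajorizingVector up lo ℓ v := by
  have h_start : fillingPath up lo 0 = lo := funext fun j => fillingPath_of_le (Nat.cast_nonneg _)
  have h_end : fillingPath up lo n = up := funext fun j =>
    fillingPath_of_add_one_le (by exact_mod_cast j.isLt)
  have hcont : Continuous fun t => ∑ j, fillingPath up lo t j := by
    unfold fillingPath
    fun_prop
  obtain ⟨t, ht, rfl⟩ : ℓ ∈ (fun t => ∑ j, fillingPath up lo t j) '' Set.Icc 0 n := by
    refine intermediate_value_Icc (Nat.cast_nonneg n) hcont.continuousOn ⟨?_, ?_⟩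
    · simpa only [h_start] using h1
    · simpa only [h_end] using h2
  exact ⟨_, isMajorizingVector_fillingPath hn hup hlo hle ht.1⟩

end MajorizingVector

section Spread

variable {ι : Type*} {s : Finset ι} {c μ : ℝ} {w v : ι → ℝ}

/-- `v` is a mean-preserving spread of `w` over `s`: both have the same sum, and passing from `w`
to `v` moves the entries above `c` up and the entries below `c` down. The entries equal to `c` may
move either way. -/
structure IsSpreadOn (s : Finset ι) (c : ℝ) (w v : ι → ℝ) : Prop where
  sum_eq : ∑ j ∈ s, w j = ∑ j ∈ s, v j
  mul_nonneg : ∀ j ∈ s, 0 ≤ (w j - c) * (v j - w j)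

lemma IsSpreadOn.filter_ne (h : IsSpreadOn s c w v)
    (hμ : ∀ j ∈ s, w j = μ → v j = μ) :
    IsSpreadOn {j ∈ s | w j ≠ μ} c w v := by
  refine ⟨?_, fun j hj => h.mul_nonneg j (Finset.mem_filter.1 hj).1⟩
  have heq : ∑ j ∈ s with w j = μ, w j = ∑ j ∈ s with w j = μ, v j :=
    Finset.sum_congr rfl fun j hj => by
      obtain ⟨hjs, hj⟩ := Finset.mem_filter.1 hj
      rw [hj, hμ j hjs hj]
  have := h.sum_eq
  rw [← Finset.sum_filter_add_sum_filter_not s (w · = μ) w,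
    ← Finset.sum_filter_add_sum_filter_not s (w · = μ) v, heq] at this
  exact add_left_cancel this

lemma IsSpreadOn.exists_le_lt (h : IsSpreadOn s c w v) (hne : ∃ j ∈ s, w j ≠ v j) :
    ∃ j ∈ s, c ≤ w j ∧ w j < v j := by
  obtain ⟨j, hj, hlt⟩ : ∃ j ∈ s, w j < v j := by
    by_contra! hle
    obtain ⟨j, hj, hjne⟩ := hne
    exact hjne ((Finset.sum_eq_sum_iff_of_le hle).1 h.sum_eq.symm j hj).symm
  exact ⟨j, hj, sub_nonneg.1 (nonneg_of_mul_nonneg_left (h.mul_nonneg j hj) (sub_pos.2 hlt)), hlt⟩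

lemma IsSpreadOn.le_of_forall_le (h : IsSpreadOn s c w v) (hc : c ≤ μ)
    (hμ : ∀ j ∈ s, v j ≤ μ) {j : ι} (hj : j ∈ s) : w j ≤ μ := by
  by_contra! hlt
  have := h.mul_nonneg j hj
  nlinarith [hμ j hj]

lemma IsSpreadOn.eq_of_eq_upper (h : IsSpreadOn s c w v) (hc : c < μ)
    (hμ : ∀ j ∈ s, v j ≤ μ) {j : ι} (hj : j ∈ s) (hw : w j = μ) : v j = μ := by
  have := h.mul_nonneg j hj
  rw [hw] at this
  exact (hμ j hj).antisymm (sub_nonneg.1 (nonneg_of_mul_nonneg_right this (sub_pos.2 hc)))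

lemma prod_lt_one_of_sum_sub_one_nonpos {r : ι → ℝ} (hr : ∀ j ∈ s, 0 ≤ r j)
    (hsum : ∑ j ∈ s, (r j - 1) ≤ 0) (hne : ∃ j ∈ s, r j ≠ 1) : ∏ j ∈ s, r j < 1 := by
  classical
  obtain ⟨k, hk, hne⟩ := hne
  have hle (j : ι) : r j ≤ Real.exp (r j - 1) := by simpa using Real.add_one_le_exp (r j - 1)
  have hlt : r k < Real.exp (r k - 1) := by
    simpa using Real.add_one_lt_exp (sub_ne_zero.2 hne)
  calc ∏ j ∈ s, r j = r k * ∏ j ∈ s.erase k, r j := (Finset.mul_prod_erase s r hk).symm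
    _ ≤ r k * ∏ j ∈ s.erase k, Real.exp (r j - 1) := mul_le_mul_of_nonneg_left
        (Finset.prod_le_prod (fun j hj => hr j (Finset.mem_of_mem_erase hj)) fun j _ => hle j)
        (hr k hk)
    _ < Real.exp (r k - 1) * ∏ j ∈ s.erase k, Real.exp (r j - 1) :=
        mul_lt_mul_of_pos_right hlt (Finset.prod_pos fun j _ => Real.exp_pos _)
    _ = Real.exp (∑ j ∈ s, (r j - 1)) := by
        rw [Finset.mul_prod_erase s (fun j => Real.exp (r j - 1)) hk, Real.exp_sum]
    _ ≤ 1 := Real.exp_le_one_iff.2 hsum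

lemma IsSpreadOn.prod_sub_lt_prod_sub (h : IsSpreadOn s c w v) (hc : c < μ)
    (hw : ∀ j ∈ s, w j < μ) (hv : ∀ j ∈ s, v j ≤ μ) (hne : ∃ j ∈ s, w j ≠ v j) :
    ∏ j ∈ s, (μ - v j) < ∏ j ∈ s, (μ - w j) := by
  have hpos (j) (hj : j ∈ s) : 0 < μ - w j := sub_pos.2 (hw j hj)
  have hratio (j) (hj : j ∈ s) : (μ - v j) / (μ - w j) - 1 = (w j - v j) / (μ - w j) := by
    have := (hpos j hj).ne'
    field_simp
    ring
  have hprod : ∏ j ∈ s, (μ - v j) / (μ - w j) < 1 := by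
    refine prod_lt_one_of_sum_sub_one_nonpos
      (fun j hj => div_nonneg (sub_nonneg.2 (hv j hj)) (hpos j hj).le) ?_ ?_
    · calc ∑ j ∈ s, ((μ - v j) / (μ - w j) - 1)
          ≤ ∑ j ∈ s, (w j - v j) / (μ - c) := Finset.sum_le_sum fun j hj => by
            rw [hratio j hj, div_le_div_iff₀ (hpos j hj) (sub_pos.2 hc)]
            linarith [h.mul_nonneg j hj]
        _ = 0 := by rw [← Finset.sum_div, Finset.sum_sub_distrib, h.sum_eq, sub_self, zero_div]
    · obtain ⟨j, hj, hjne⟩ := hne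
      refine ⟨j, hj, fun h1 => hjne ?_⟩
      linarith [(div_eq_one_iff_eq (hpos j hj).ne').1 h1]
  rwa [Finset.prod_div_distrib, div_lt_one (Finset.prod_pos hpos)] at hprod

lemma IsMajorizingVector.isSpreadOn {n : ℕ} {up lo v w : Fin n → ℝ}
    (hv : IsMajorizingVector up lo (∑ j, w j) v) (hw : Antitone w) (h1 : lo ≤ w) (h2 : w ≤ up) :
    ∃ c, IsSpreadOn Finset.univ c w v := by
  have hsum := hv.sum_eq
  obtain ⟨i, η, head, -, tail, -⟩ := hv
  refine ⟨w i, hsum.symm, fun j _ => ?_⟩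
  rcases lt_trichotomy j i with hj | rfl | hj
  · exact mul_nonneg (sub_nonneg.2 (hw hj.le)) (sub_nonneg.2 ((head j hj).symm ▸ h2 j))
  · simp
  · exact mul_nonneg_of_nonpos_of_nonpos (sub_nonpos.2 (hw hj.le))
      (sub_nonpos.2 ((tail j hj).symm ▸ h1 j))

end Spread

section ExpTail

open MeasureTheory Filter Set Topology
open Real (exp exp_pos exp_add exp_lt_exp exp_le_exp)
open scoped ENNReal

variable {ν κ κ' : Measure ℝ} {γ s : ℝ}

/-- The tail of `ν` is asymptotically exponential with rate `γ`: moving the threshold down by `b`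
multiplies the tail by a factor tending to `exp (γ * b)`. As `0 / 0 = ∞ / ∞ = 0` in `ℝ≥0∞`, this
forces the tails to be positive and eventually finite. -/
def HasExpTail (ν : Measure ℝ) (γ : ℝ) : Prop :=
  ∀ b, Tendsto (fun t => ν (Ioi (t - b)) / ν (Ioi t)) atTop (𝓝 (.ofReal (exp (γ * b))))

lemma ofReal_exp_ne_zero (x : ℝ) : ENNReal.ofReal (exp x) ≠ 0 :=
  (ENNReal.ofReal_pos.2 (exp_pos x)).ne'

lemma ofReal_exp_add (x y : ℝ) :
    ENNReal.ofReal (exp (x + y)) = ENNReal.ofReal (exp x) * ENNReal.ofReal (exp y) := by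
  rw [exp_add, ENNReal.ofReal_mul (exp_pos x).le]

lemma HasExpTail.measure_Ioi_ne_zero (hν : HasExpTail ν γ) (t : ℝ) : ν (Ioi t) ≠ 0 := by
  obtain ⟨u, hu, htu⟩ :=
    (((hν 0).eventually_ne (ofReal_exp_ne_zero _)).and (eventually_ge_atTop t)).exists
  intro h0
  have : ν (Ioi u) = 0 := measure_mono_null (Ioi_subset_Ioi htu) h0
  simp [this] at hu

lemma HasExpTail.eventually_shift_le (hν : HasExpTail ν γ) [IsFiniteMeasure ν] (hs : γ < s) :
    ∀ᶠ t in atTop, ν (Ioi (t - 1)) ≤ .ofReal (exp s) * ν (Ioi t) := by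
  have hlt : ENNReal.ofReal (exp (γ * 1)) < .ofReal (exp s) := by
    rw [mul_one]
    exact (ENNReal.ofReal_lt_ofReal_iff (exp_pos s)).2 (exp_lt_exp.2 hs)
  filter_upwards [(hν 1).eventually_lt_const hlt] with t ht
  exact (ENNReal.div_le_iff (hν.measure_Ioi_ne_zero t) (measure_ne_top _ _)).1 ht.le

lemma HasExpTail.exists_shift_natCast_le (hν : HasExpTail ν γ) [IsFiniteMeasure ν] (hs : γ < s)
    (hs0 : 0 ≤ s) :
    ∃ C ≠ ∞, ∃ U, ∀ t ≥ U, ∀ n : ℕ,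
      ν (Ioi (t - n)) ≤ C * .ofReal (exp (s * n)) * ν (Ioi t) := by
  obtain ⟨U, hU⟩ := eventually_atTop.1 (hν.eventually_shift_le hs)
  set C := ν univ / ν (Ioi (U + 1))
  have hC : C ≠ ∞ := ENNReal.div_ne_top (measure_ne_top _ _) (hν.measure_Ioi_ne_zero _)
  have hCmul : ν univ = C * ν (Ioi (U + 1)) :=
    (ENNReal.div_mul_cancel (hν.measure_Ioi_ne_zero _) (measure_ne_top _ _)).symm
  have hexp (n : ℕ) : 1 ≤ ENNReal.ofReal (exp (s * n)) :=
    ENNReal.one_le_ofReal.2 (Real.one_le_exp (by positivity))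
  have hsmall (t : ℝ) (ht : t ≤ U + 1) (n : ℕ) (x : ℝ) :
      ν (Ioi x) ≤ C * .ofReal (exp (s * n)) * ν (Ioi t) := by
    calc ν (Ioi x) ≤ ν univ := measure_mono (subset_univ _)
      _ = C * 1 * ν (Ioi (U + 1)) := by rw [mul_one, hCmul]
      _ ≤ C * .ofReal (exp (s * n)) * ν (Ioi t) := by gcongr; exact hexp n
  refine ⟨C, hC, U, fun t ht n => ?_⟩
  induction n generalizing t with
  | zero =>
    have hC1 : 1 ≤ C := by
      rw [← ENNReal.div_self (hν.measure_Ioi_ne_zero (U + 1)) (measure_ne_top _ _)]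
      exact ENNReal.div_le_div_right (measure_mono (subset_univ _)) _
    simpa using mul_le_mul_left hC1 (ν (Ioi t))
  | succ n ih =>
    rcases le_or_gt t (U + 1) with h | h
    · exact hsmall t h _ _
    · calc ν (Ioi (t - (n + 1 : ℕ))) = ν (Ioi (t - 1 - n)) := by push_cast; ring_nf
        _ ≤ C * .ofReal (exp (s * n)) * ν (Ioi (t - 1)) := ih _ (by linarith)
        _ ≤ C * .ofReal (exp (s * n)) * (.ofReal (exp s) * ν (Ioi t)) := by
          gcongr; exact hU t ht
        _ = C * .ofReal (exp (s * (n + 1 : ℕ))) * ν (Ioi t) := by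
          push_cast
          rw [mul_add, mul_one, ofReal_exp_add]
          ring

-- Potter's bound for the regularly varying function `x ↦ ν (Ioi (log x))`.
lemma HasExpTail.exists_shift_le (hν : HasExpTail ν γ) [IsFiniteMeasure ν] (hs : γ < s)
    (hs0 : 0 ≤ s) :
    ∃ C ≠ ∞, ∃ U, ∀ t ≥ U, ∀ b ≥ 0, ν (Ioi (t - b)) ≤ C * .ofReal (exp (s * b)) * ν (Ioi t) := by
  obtain ⟨C, hC, U, hCU⟩ := hν.exists_shift_natCast_le hs hs0
  refine ⟨C * .ofReal (exp s), ENNReal.mul_ne_top hC ENNReal.ofReal_ne_top, U,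
    fun t ht b hb => ?_⟩
  calc ν (Ioi (t - b)) ≤ ν (Ioi (t - ⌈b⌉₊)) :=
        measure_mono (Ioi_subset_Ioi (by linarith [Nat.le_ceil b]))
    _ ≤ C * .ofReal (exp (s * ⌈b⌉₊)) * ν (Ioi t) := hCU t ht _
    _ ≤ C * .ofReal (exp (s + s * b)) * ν (Ioi t) := by
      gcongr
      nlinarith [Nat.ceil_lt_add_one hb]
    _ = C * .ofReal (exp s) * .ofReal (exp (s * b)) * ν (Ioi t) := by
      rw [ofReal_exp_add, ← mul_assoc C]

lemma lintegral_exp_mul_ge (κ : Measure ℝ) (hs : 0 ≤ s) (t : ℝ) :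
    .ofReal (exp (s * t)) * κ (Ioi t) ≤ ∫⁻ x, .ofReal (exp (s * x)) ∂κ := by
  refine le_trans (mul_le_mul_right (measure_mono fun x hx => ?_) _)
    (mul_meas_ge_le_lintegral (f := fun x => ENNReal.ofReal (exp (s * x))) (by fun_prop) _)
  exact ENNReal.ofReal_le_ofReal (exp_le_exp.2 (mul_le_mul_of_nonneg_left (le_of_lt hx) hs))

lemma HasExpTail.tendsto_exp_mul_measure_Ioi (hν : HasExpTail ν γ) [IsFiniteMeasure ν]
    (hγ : 0 ≤ γ) (hs : γ < s) :
    Tendsto (fun t => .ofReal (exp (s * t)) * ν (Ioi t)) atTop (𝓝 ∞) := by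
  obtain ⟨r, hγr, hrs⟩ := exists_between hs
  obtain ⟨C, hC, U, hCU⟩ := hν.exists_shift_le hγr (hγ.trans hγr.le)
  have hexp : Tendsto (fun t => ENNReal.ofReal (exp ((s - r) * t + r * U))) atTop (𝓝 ∞) := by
    refine ENNReal.tendsto_ofReal_atTop.comp (Real.tendsto_exp_atTop.comp ?_)
    exact tendsto_atTop_add_const_right _ _ (tendsto_id.const_mul_atTop (sub_pos.2 hrs))
  have hC0 : ν (Ioi U) / C ≠ 0 := ENNReal.div_ne_zero.2 ⟨hν.measure_Ioi_ne_zero U, hC⟩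
  have hlim := ENNReal.Tendsto.mul_const (b := ν (Ioi U) / C) hexp (.inl ENNReal.top_ne_zero)
  rw [ENNReal.top_mul hC0] at hlim
  refine tendsto_nhds_top_mono hlim ?_
  filter_upwards [eventually_ge_atTop U] with t ht
  have hU : ν (Ioi U) ≤ C * (.ofReal (exp (r * (t - U))) * ν (Ioi t)) := by
    simpa [mul_assoc] using hCU t ht (t - U) (sub_nonneg.2 ht)
  calc .ofReal (exp ((s - r) * t + r * U)) * (ν (Ioi U) / C)
      ≤ .ofReal (exp ((s - r) * t + r * U)) * (.ofReal (exp (r * (t - U))) * ν (Ioi t)) := by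
        gcongr
        exact ENNReal.div_le_of_le_mul' hU
    _ = .ofReal (exp (s * t)) * ν (Ioi t) := by
        rw [← mul_assoc, ← ofReal_exp_add]
        ring_nf

lemma HasExpTail.eventually_measure_Ioi_le (hν : HasExpTail ν γ) [IsFiniteMeasure ν]
    (hγ : 0 ≤ γ) (hs : γ < s) (hκ : ∫⁻ x, .ofReal (exp (s * x)) ∂κ ≠ ∞) :
    ∀ᶠ t in atTop, κ (Ioi t) ≤ ν (Ioi t) := by
  filter_upwards [(hν.tendsto_exp_mul_measure_Ioi hγ hs).eventually_const_lt hκ.lt_top] with t ht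
  have := (lintegral_exp_mul_ge κ (hγ.trans hs.le) t).trans ht.le
  exact (ENNReal.mul_le_mul_iff_right (ofReal_exp_ne_zero _) ENNReal.ofReal_ne_top).1 this

lemma conv_Ioi (ν κ : Measure ℝ) [SFinite ν] [SFinite κ] (t : ℝ) :
    (ν ∗ κ) (Ioi t) = ∫⁻ b, ν (Ioi (t - b)) ∂κ := by
  rw [Measure.conv_comm, ← lintegral_indicator_one measurableSet_Ioi,
    Measure.lintegral_conv (measurable_one.indicator measurableSet_Ioi)]
  refine lintegral_congr fun b => ?_
  rw [← lintegral_indicator_one measurableSet_Ioi]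
  refine lintegral_congr fun x => ?_
  simp [indicator_apply, sub_lt_iff_lt_add']

lemma measurable_measure_Ioi_sub (ν : Measure ℝ) (t : ℝ) : Measurable fun b => ν (Ioi (t - b)) :=
  Monotone.measurable fun _ _ hab => measure_mono (Ioi_subset_Ioi (sub_le_sub_left hab t))

lemma conv_Ioi_div (ν κ : Measure ℝ) [SFinite ν] [SFinite κ] (t : ℝ) :
    (ν ∗ κ) (Ioi t) / ν (Ioi t) = ∫⁻ b, ν (Ioi (t - b)) / ν (Ioi t) ∂κ := by
  simp only [conv_Ioi, div_eq_mul_inv]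
  exact (lintegral_mul_const _ (measurable_measure_Ioi_sub ν t)).symm

lemma HasExpTail.tendsto_conv_Ioi_div (hν : HasExpTail ν γ) [IsFiniteMeasure ν] [SFinite κ]
    (hs : γ < s) (hs0 : 0 ≤ s) (hκ0 : ∀ᵐ b ∂κ, 0 ≤ b)
    (hκ : ∫⁻ b, .ofReal (exp (s * b)) ∂κ ≠ ∞) :
    Tendsto (fun t => (ν ∗ κ) (Ioi t) / ν (Ioi t)) atTop
      (𝓝 (∫⁻ b, .ofReal (exp (γ * b)) ∂κ)) := by
  obtain ⟨C, hC, U, hCU⟩ := hν.exists_shift_le hs hs0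
  simp only [conv_Ioi_div]
  refine tendsto_lintegral_filter_of_dominated_convergence
    (fun b => C * .ofReal (exp (s * b)))
    (.of_forall fun t => (measurable_measure_Ioi_sub ν t).div_const _) ?_ ?_
    (.of_forall hν)
  · filter_upwards [eventually_ge_atTop U] with t ht
    filter_upwards [hκ0] with b hb
    exact ENNReal.div_le_of_le_mul (hCU t ht b hb)
  · rw [lintegral_const_mul _ (by fun_prop)]
    exact ENNReal.mul_ne_top hC hκ

lemma HasExpTail.le_liminf_conv_Ioi_div (hν : HasExpTail ν γ) [SFinite ν] [SFinite κ] :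
    ∫⁻ b, .ofReal (exp (γ * b)) ∂κ ≤ liminf (fun t => (ν ∗ κ) (Ioi t) / ν (Ioi t)) atTop := by
  simp only [conv_Ioi_div]
  refine le_trans (lintegral_congr fun b => (hν b).liminf_eq.symm).le
    (lintegral_liminf_le fun t => (measurable_measure_Ioi_sub ν t).div_const _)

lemma HasExpTail.eventually_conv_Ioi_le (hν : HasExpTail ν γ) [IsFiniteMeasure ν] [SFinite κ]
    [SFinite κ'] (hs : γ < s) (hs0 : 0 ≤ s) (hκ0 : ∀ᵐ b ∂κ, 0 ≤ b)
    (hκ : ∫⁻ b, .ofReal (exp (s * b)) ∂κ ≠ ∞)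
    (hlt : ∫⁻ b, .ofReal (exp (γ * b)) ∂κ < ∫⁻ b, .ofReal (exp (γ * b)) ∂κ') :
    ∀ᶠ t in atTop, (ν ∗ κ) (Ioi t) ≤ (ν ∗ κ') (Ioi t) := by
  obtain ⟨c, hκc, hcκ'⟩ := exists_between hlt
  filter_upwards [(hν.tendsto_conv_Ioi_div hs hs0 hκ0 hκ).eventually_lt_const hκc,
    eventually_lt_of_lt_liminf (hcκ'.trans_le hν.le_liminf_conv_Ioi_div)] with t h h'
  simpa only [ENNReal.div_mul_cancel (hν.measure_Ioi_ne_zero t) (measure_ne_top _ _)]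
    using mul_le_mul_left (h.trans h').le (ν (Ioi t))

end ExpTail

section ExpTailDensity

open MeasureTheory ProbabilityTheory Filter Set Topology
open Real (exp)
open scoped ENNReal

variable {f : ℝ → ℝ≥0∞} {γ : ℝ}

lemma withDensity_Ioi_sub (hf : Measurable f) (t b : ℝ) :
    volume.withDensity f (Ioi (t - b)) = ∫⁻ x in Ioi t, f (x - b) := by
  rw [withDensity_apply _ measurableSet_Ioi,
    ← (measurePreserving_sub_right volume b).setLIntegral_comp_preimage measurableSet_Ioi hf,
    preimage_sub_const_Ioi, sub_add_cancel]

lemma withDensity_Ioi_ne_zero (hf : Measurable f) (hf0 : ∀ᶠ x in atTop, f x ≠ 0) (t : ℝ) :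
    volume.withDensity f (Ioi t) ≠ 0 := by
  obtain ⟨u, hu⟩ := eventually_atTop.1 hf0
  rw [withDensity_apply _ measurableSet_Ioi, ← pos_iff_ne_zero, setLIntegral_pos_iff hf]
  have hpos : 0 < volume (Ioi (max t u)) := by simp
  refine hpos.trans_le (measure_mono fun x hx => ?_)
  exact ⟨hu x ((le_max_right t u).trans (le_of_lt hx)), (le_max_left t u).trans_lt hx⟩

lemma hasExpTail_withDensity (hf : Measurable f) [IsFiniteMeasure (volume.withDensity f)]
    (hlim : ∀ b, Tendsto (fun x => f (x - b) / f x) atTop (𝓝 (.ofReal (exp (γ * b))))) :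
    HasExpTail (volume.withDensity f) γ := by
  have hf0 : ∀ᶠ x in atTop, f x ≠ 0 ∧ f x ≠ ∞ := by
    filter_upwards [(hlim 0).eventually_ne (ofReal_exp_ne_zero _)] with x hx
    constructor <;> intro h <;> simp [h] at hx
  have hpos := withDensity_Ioi_ne_zero hf (hf0.mono fun _ h => h.1)
  refine fun b => tendsto_order.2 ⟨fun c hc => ?_, fun c hc => ?_⟩
  · obtain ⟨d, hcd, hd⟩ := exists_between hc
    obtain ⟨u, hu⟩ := eventually_atTop.1 (((hlim b).eventually_const_lt hd).and hf0)
    filter_upwards [eventually_ge_atTop u] with t ht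
    refine hcd.trans_le ?_
    rw [ENNReal.le_div_iff_mul_le (.inl (hpos t)) (.inl (measure_ne_top _ _)),
      withDensity_Ioi_sub hf, withDensity_apply _ measurableSet_Ioi, ← lintegral_const_mul _ hf]
    refine setLIntegral_mono (by fun_prop) fun x hx => ?_
    obtain ⟨hlt, h0, htop⟩ := hu x (ht.trans (le_of_lt hx))
    exact (ENNReal.le_div_iff_mul_le (.inl h0) (.inl htop)).1 hlt.le
  · obtain ⟨d, hd, hdc⟩ := exists_between hc
    obtain ⟨u, hu⟩ := eventually_atTop.1 (((hlim b).eventually_lt_const hd).and hf0)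
    filter_upwards [eventually_ge_atTop u] with t ht
    refine lt_of_le_of_lt ?_ hdc
    rw [ENNReal.div_le_iff (hpos t) (measure_ne_top _ _),
      withDensity_Ioi_sub hf, withDensity_apply _ measurableSet_Ioi, ← lintegral_const_mul _ hf]
    refine setLIntegral_mono (by fun_prop) fun x hx => ?_
    obtain ⟨hlt, h0, htop⟩ := hu x (ht.trans (le_of_lt hx))
    exact (ENNReal.div_le_iff h0 htop).1 hlt.le

lemma hasExpTail_gammaMeasure {a r : ℝ} (ha : 0 < a) (hr : 0 < r) :
    HasExpTail (gammaMeasure a r) r := by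
  have := isProbabilityMeasure_gammaMeasure ha hr
  rw [gammaMeasure] at this ⊢
  refine hasExpTail_withDensity (measurable_gammaPDFReal a r).ennreal_ofReal fun b => ?_
  have hratio : Tendsto (fun x => ((x - b) / x) ^ (a - 1) * exp (r * b)) atTop
      (𝓝 (exp (r * b))) := by
    have hdiv : Tendsto (fun x => (x - b) / x) atTop (𝓝 1) := by
      have h : Tendsto (fun x => 1 - b / x) atTop (𝓝 (1 - 0)) :=
        (tendsto_const_nhds.div_atTop tendsto_id).const_sub 1
      rw [sub_zero] at h
      refine h.congr' ?_
      filter_upwards [eventually_ne_atTop 0] with x hx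
      rw [sub_div, div_self hx]
    simpa using (hdiv.rpow_const (.inl one_ne_zero)).mul_const (exp (r * b))
  refine (ENNReal.tendsto_ofReal hratio).congr' ?_
  filter_upwards [eventually_gt_atTop 0, eventually_gt_atTop b] with x hx hxb
  have := Real.Gamma_pos_of_pos ha
  rw [gammaPDF_of_nonneg (sub_pos.2 hxb).le, gammaPDF_of_nonneg hx.le,
    ← ENNReal.ofReal_div_of_pos (by positivity), Real.div_rpow (sub_pos.2 hxb).le hx.le,
    show -(r * (x - b)) = r * b + -(r * x) by ring, Real.exp_add]
  congr 1
  field_simp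

end ExpTailDensity

section ExpMoments

open MeasureTheory ProbabilityTheory Filter Set Topology
open Real (exp exp_pos)
open scoped ENNReal

lemma mgf_id_eq_toReal_lintegral (ν : Measure ℝ) (t : ℝ) :
    mgf id ν t = (∫⁻ x, .ofReal (exp (t * x)) ∂ν).toReal :=
  integral_eq_lintegral_of_nonneg_ae (.of_forall fun _ => (exp_pos _).le) (by fun_prop)

lemma ext_of_lintegral_exp_mul {ν ν' : Measure ℝ} [IsFiniteMeasure ν] [IsFiniteMeasure ν']
    (h : ∀ t, ∫⁻ x, .ofReal (exp (t * x)) ∂ν = ∫⁻ x, .ofReal (exp (t * x)) ∂ν')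
    (h0 : ∀ᶠ t in 𝓝 0, ∫⁻ x, .ofReal (exp (t * x)) ∂ν ≠ ∞) : ν = ν' := by
  have hmgf : mgf id ν = mgf id ν' := by
    ext t
    rw [mgf_id_eq_toReal_lintegral, h, mgf_id_eq_toReal_lintegral]
  have hmass : ν = 0 ↔ ν' = 0 := by
    have huniv : ν univ = ν' univ := by simpa using h 0
    rw [← Measure.measure_univ_eq_zero, huniv, Measure.measure_univ_eq_zero]
  have hint : 0 ∈ interior (integrableExpSet id ν) := by
    rw [mem_interior_iff_mem_nhds]
    filter_upwards [h0] with t ht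
    exact (lintegral_ofReal_ne_top_iff_integrable (by fun_prop)
      (.of_forall fun _ => (exp_pos _).le)).1 ht
  refine Measure.ext_of_charFun (funext fun t => ?_)
  rw [← complexMGF_id_mul_I, ← complexMGF_id_mul_I]
  exact eqOn_complexMGF_of_mgf' hmgf hmass (by simpa using hint)

section Gamma

variable {a r t : ℝ}

lemma exp_mul_gammaPDF (ha : 0 < a) (hr : 0 < r) (ht : t < r) (x : ℝ) :
    gammaPDF a r x * .ofReal (exp (t * x)) =
      .ofReal (1 - t / r) ^ (-a) * gammaPDF a (r - t) x := by
  rcases lt_or_ge x 0 with hx | hx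
  · simp only [gammaPDF_of_neg hx, zero_mul, mul_zero]
  have hrt : 0 < r - t := sub_pos.2 ht
  have := Real.Gamma_pos_of_pos ha
  rw [gammaPDF_of_nonneg hx, gammaPDF_of_nonneg hx, one_sub_div hr.ne',
    ENNReal.ofReal_rpow_of_pos (div_pos hrt hr), ← ENNReal.ofReal_mul (by positivity),
    ← ENNReal.ofReal_mul (by positivity), Real.rpow_neg (by positivity),
    Real.div_rpow hrt.le hr.le, show -((r - t) * x) = -(r * x) + t * x by ring, Real.exp_add]
  congr 1
  field_simp

lemma lintegral_exp_mul_gammaMeasure_of_lt (ha : 0 < a) (hr : 0 < r) (ht : t < r) :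
    ∫⁻ x, .ofReal (exp (t * x)) ∂gammaMeasure a r = .ofReal (1 - t / r) ^ (-a) := by
  have hm (q : ℝ) : Measurable (gammaPDF a q) := (measurable_gammaPDFReal a q).ennreal_ofReal
  rw [gammaMeasure, lintegral_withDensity_eq_lintegral_mul _ (hm r) (by fun_prop)]
  simp only [Pi.mul_apply, exp_mul_gammaPDF ha hr ht]
  rw [lintegral_const_mul _ (hm _), lintegral_gammaPDF_eq_one ha (sub_pos.2 ht), mul_one]

lemma ae_nonneg_gammaMeasure (a r : ℝ) : ∀ᵐ x ∂gammaMeasure a r, 0 ≤ x := by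
  rw [gammaMeasure, ae_withDensity_iff (f := gammaPDF a r)
    (measurable_gammaPDFReal a r).ennreal_ofReal]
  exact .of_forall fun x hx => not_lt.1 fun h => hx (gammaPDF_of_neg h)

lemma lintegral_exp_mul_gammaMeasure (ha : 0 < a) (hr : 0 < r) (t : ℝ) :
    ∫⁻ x, .ofReal (exp (t * x)) ∂gammaMeasure a r = .ofReal (1 - t / r) ^ (-a) := by
  rcases lt_or_ge t r with ht | ht
  · exact lintegral_exp_mul_gammaMeasure_of_lt ha hr ht
  have hlim : Tendsto (fun q => ENNReal.ofReal (1 - q / r) ^ (-a)) (𝓝[<] r) (𝓝 ∞) := by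
    have hcont : Continuous fun q => ENNReal.ofReal (1 - q / r) ^ (-a) :=
      ENNReal.continuous_rpow_const.comp (ENNReal.continuous_ofReal.comp (by fun_prop))
    have := hcont.tendsto r
    rw [div_self hr.ne', sub_self, ENNReal.ofReal_zero, ENNReal.zero_rpow_of_neg (by simpa)] at this
    exact this.mono_left nhdsWithin_le_nhds
  have hzero : ENNReal.ofReal (1 - t / r) = 0 :=
    ENNReal.ofReal_of_nonpos (sub_nonpos.2 ((one_le_div hr).2 ht))
  rw [hzero, ENNReal.zero_rpow_of_neg (by simpa), eq_top_iff]
  refine le_of_tendsto hlim ?_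
  filter_upwards [self_mem_nhdsWithin] with q hq
  rw [← lintegral_exp_mul_gammaMeasure_of_lt ha hr hq]
  refine lintegral_mono_ae ?_
  filter_upwards [ae_nonneg_gammaMeasure a r] with x hx
  gcongr
  exact (le_of_lt hq).trans ht

end Gamma

lemma lintegral_exp_mul_sq_gaussianReal (t : ℝ) :
    ∫⁻ x, .ofReal (exp (t * x ^ 2)) ∂gaussianReal 0 1 =
      ENNReal.ofReal (1 - 2 * t) ^ (-(1 / 2) : ℝ) := by
  have hdensity : ∫⁻ x, .ofReal (exp (t * x ^ 2)) ∂gaussianReal 0 1 =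
      ∫⁻ x, .ofReal ((√(2 * Real.pi))⁻¹ * exp (-(1 / 2 - t) * x ^ 2)) := by
    rw [gaussianReal_of_var_ne_zero _ one_ne_zero,
      lintegral_withDensity_eq_lintegral_mul _ (measurable_gaussianPDF 0 1) (by fun_prop)]
    refine lintegral_congr fun x => ?_
    rw [Pi.mul_apply, gaussianPDF, ← ENNReal.ofReal_mul (gaussianPDFReal_nonneg _ _ _)]
    simp only [gaussianPDFReal, NNReal.coe_one, mul_one, sub_zero]
    rw [mul_assoc, ← Real.exp_add]
    ring_nf
  rw [hdensity]
  rcases lt_or_ge t (1 / 2) with ht | ht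
  · have h : 0 < 1 - 2 * t := by linarith
    have : 1 / 2 - t ≠ 0 := by linarith
    rw [← ofReal_integral_eq_lintegral_ofReal
      ((integrable_exp_neg_mul_sq (by linarith)).const_mul _) (.of_forall fun x => by positivity),
      integral_const_mul, integral_gaussian, ENNReal.ofReal_rpow_of_pos h, Real.rpow_neg h.le,
      ← Real.sqrt_eq_rpow, ← Real.sqrt_inv, ← Real.sqrt_inv, ← Real.sqrt_mul (by positivity)]
    congr 2
    field_simp
  · rw [ENNReal.ofReal_of_nonpos (by linarith), ENNReal.zero_rpow_of_neg (by norm_num), eq_top_iff]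
    calc ∞ = ∫⁻ _ : ℝ, ENNReal.ofReal (√(2 * Real.pi))⁻¹ := by
          rw [lintegral_const, Real.volume_univ, ENNReal.mul_top]
          simp [Real.pi_pos]
      _ ≤ _ := lintegral_mono fun x => ENNReal.ofReal_le_ofReal <|
          le_mul_of_one_le_right (by positivity) (Real.one_le_exp (by nlinarith [sq_nonneg x]))

end ExpMoments

section ChiSquareSums

open MeasureTheory ProbabilityTheory Filter Set Topology
open Real (exp exp_pos)
open scoped ENNReal

variable {ι : Type*} {s t : Finset ι} {w v : ι → ℝ} {μ : ℝ}

lemma measurable_sum_mul_sq (s : Finset ι) (w : ι → ℝ) :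
    Measurable fun z : ι → ℝ => ∑ j ∈ s, w j * z j ^ 2 := by
  fun_prop

variable [Fintype ι]

/-- The law of the partial sum `∑ j ∈ s, w j * z j ^ 2` of independent standard normal `z j`. The
`z j` with `j ∉ s` are kept, so that all these sums are random variables on one product space. -/
noncomputable def chiSqSumLaw (s : Finset ι) (w : ι → ℝ) : Measure ℝ :=
  (Measure.pi fun _ : ι => gaussianReal 0 1).map fun z => ∑ j ∈ s, w j * z j ^ 2

instance isProbabilityMeasure_chiSqSumLaw (s : Finset ι) (w : ι → ℝ) :
    IsProbabilityMeasure (chiSqSumLaw s w) :=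
  Measure.isProbabilityMeasure_map (measurable_sum_mul_sq s w).aemeasurable

lemma chiSqSumLaw_congr (h : ∀ j ∈ s, w j = v j) : chiSqSumLaw s w = chiSqSumLaw s v := by
  unfold chiSqSumLaw
  congr with z
  exact Finset.sum_congr rfl fun j hj => by rw [h j hj]

lemma ae_nonneg_chiSqSumLaw (hw : ∀ j ∈ s, 0 ≤ w j) : ∀ᵐ x ∂chiSqSumLaw s w, 0 ≤ x := by
  rw [chiSqSumLaw, ae_map_iff (measurable_sum_mul_sq s w).aemeasurable measurableSet_Ici]
  exact .of_forall fun z => Finset.sum_nonneg fun j hj => mul_nonneg (hw j hj) (sq_nonneg _)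

lemma chiSqSumLaw_Ioi_mono (hst : s ⊆ t) (hw : ∀ j ∈ t, 0 ≤ w j) (x : ℝ) :
    chiSqSumLaw s w (Ioi x) ≤ chiSqSumLaw t w (Ioi x) := by
  simp only [chiSqSumLaw, Measure.map_apply (measurable_sum_mul_sq _ w) measurableSet_Ioi]
  exact measure_mono fun z hz => lt_of_lt_of_le hz <|
    Finset.sum_le_sum_of_subset_of_nonneg hst fun j hj _ => mul_nonneg (hw j hj) (sq_nonneg _)

lemma chiSqSumLaw_union [DecidableEq ι] (hst : Disjoint s t) (w : ι → ℝ) :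
    chiSqSumLaw (s ∪ t) w = chiSqSumLaw s w ∗ chiSqSumLaw t w := by
  have hindep := (iIndepFun_pi (μ := fun _ : ι => gaussianReal 0 1) (X := fun _ => id)
    fun _ => aemeasurable_id).indepFun_finset s t hst measurable_pi_apply
  have hsum (u : Finset ι) : Measurable fun y : u → ℝ => ∑ j : u, w j * y j ^ 2 := by fun_prop
  have hconv := (hindep.comp (hsum s) (hsum t)).map_add_eq_map_conv_map
    (by fun_prop) (by fun_prop)
  have hattach (u : Finset ι) : ((fun y : u → ℝ => ∑ j : u, w j * y j ^ 2) ∘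
      fun (z : ι → ℝ) (j : u) => id (z j)) = fun z => ∑ j ∈ u, w j * z j ^ 2 := by
    ext z
    exact Finset.sum_coe_sort u fun j => w j * z j ^ 2
  rw [hattach, hattach] at hconv
  rw [chiSqSumLaw, chiSqSumLaw, chiSqSumLaw, ← hconv]
  congr with z
  exact Finset.sum_union hst

lemma lintegral_exp_mul_chiSqSumLaw (s : Finset ι) (w : ι → ℝ) (q : ℝ) :
    ∫⁻ x, .ofReal (exp (q * x)) ∂chiSqSumLaw s w =
      (∏ j ∈ s, ENNReal.ofReal (1 - 2 * (q * w j))) ^ (-(1 / 2) : ℝ) := by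
  have hm (j : ι) : Measurable fun x : ℝ => ENNReal.ofReal (exp (q * (w j * x ^ 2))) := by
    fun_prop
  have hindep := iIndepFun_pi (μ := fun _ : ι => gaussianReal 0 1) fun j => (hm j).aemeasurable
  rw [chiSqSumLaw, lintegral_map (by fun_prop) (measurable_sum_mul_sq s w),
    ← ENNReal.prod_rpow_of_ne_top fun _ _ => ENNReal.ofReal_ne_top]
  simp only [Finset.mul_sum, Real.exp_sum,
    ENNReal.ofReal_prod_of_nonneg fun _ _ => (exp_pos _).le]
  rw [lintegral_prod_eq_prod_lintegral_of_indepFun s _ hindep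
    fun j => (hm j).comp (measurable_pi_apply j)]
  refine Finset.prod_congr rfl fun j _ => ?_
  rw [← lintegral_exp_mul_sq_gaussianReal]
  simp only [mul_assoc]
  exact (measurePreserving_eval (fun _ : ι => gaussianReal 0 1) j).lintegral_comp (hm j)

lemma lintegral_exp_mul_chiSqSumLaw_ne_top {q : ℝ} (h : ∀ j ∈ s, 2 * (q * w j) < 1) :
    ∫⁻ x, .ofReal (exp (q * x)) ∂chiSqSumLaw s w ≠ ∞ := by
  rw [lintegral_exp_mul_chiSqSumLaw]
  exact ENNReal.rpow_ne_top_of_ne_zero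
    (Finset.prod_ne_zero_iff.2 fun j hj => (ENNReal.ofReal_pos.2 (sub_pos.2 (h j hj))).ne')
    (ENNReal.prod_ne_top fun _ _ => ENNReal.ofReal_ne_top)

lemma chiSqSumLaw_eq_gammaMeasure (hs : s.Nonempty) (hμ : 0 < μ) (hw : ∀ j ∈ s, w j = μ) :
    chiSqSumLaw s w = gammaMeasure (s.card / 2) (1 / (2 * μ)) := by
  have hcard : (0 : ℝ) < s.card / 2 := by
    have := hs.card_pos
    positivity
  have := isProbabilityMeasure_gammaMeasure hcard (r := 1 / (2 * μ)) (by positivity)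
  refine ext_of_lintegral_exp_mul (fun q => ?_) ?_
  · rw [lintegral_exp_mul_gammaMeasure hcard (by positivity), lintegral_exp_mul_chiSqSumLaw,
      Finset.prod_congr rfl fun j hj => by rw [hw j hj], Finset.prod_const, ← ENNReal.rpow_natCast,
      ← ENNReal.rpow_mul]
    congr 2 <;> field_simp
  · have hlim : Tendsto (fun q : ℝ => 2 * (q * μ)) (𝓝 0) (𝓝 0) := by
      have : Continuous fun q : ℝ => 2 * (q * μ) := by fun_prop
      simpa using this.tendsto 0
    filter_upwards [hlim.eventually_lt_const one_pos] with q hq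
    exact lintegral_exp_mul_chiSqSumLaw_ne_top fun j hj => by rwa [hw j hj]

lemma hasExpTail_chiSqSumLaw (hs : s.Nonempty) (hμ : 0 < μ) (hw : ∀ j ∈ s, w j = μ) :
    HasExpTail (chiSqSumLaw s w) (1 / (2 * μ)) := by
  rw [chiSqSumLaw_eq_gammaMeasure hs hμ hw]
  exact hasExpTail_gammaMeasure (by have := hs.card_pos; positivity) (by positivity)

lemma chiSqSumLaw_Ioi_ne_zero {k : ι} (hv : ∀ j ∈ s, 0 ≤ v j) (hk : k ∈ s) (hvk : 0 < v k) (x : ℝ) :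
    chiSqSumLaw s v (Ioi x) ≠ 0 := by
  have htail : HasExpTail (chiSqSumLaw {k} v) (1 / (2 * v k)) :=
    hasExpTail_chiSqSumLaw (Finset.singleton_nonempty k) hvk (by simp)
  exact fun h => htail.measure_Ioi_ne_zero x <|
    le_zero_iff.1 (h ▸ chiSqSumLaw_Ioi_mono (Finset.singleton_subset_iff.2 hk) hv x)

lemma exists_lintegral_exp_mul_chiSqSumLaw_ne_top (hμ : 0 < μ) (hw : ∀ j ∈ s, w j < μ) :
    ∃ q > 1 / (2 * μ), ∫⁻ x, .ofReal (exp (q * x)) ∂chiSqSumLaw s w ≠ ∞ := by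
  have hev : ∀ᶠ q in 𝓝[>] (1 / (2 * μ)), ∀ j ∈ s, 2 * (q * w j) < 1 := by
    refine (Finset.eventually_all s).2 fun j hj => ?_
    have hcont : Continuous fun q : ℝ => 2 * (q * w j) := by fun_prop
    refine (hcont.tendsto (1 / (2 * μ))).mono_left nhdsWithin_le_nhds |>.eventually_lt_const ?_
    calc 2 * (1 / (2 * μ) * w j) = w j / μ := by field_simp
      _ < 1 := (div_lt_one hμ).2 (hw j hj)
  obtain ⟨q, hq, hμq⟩ := (hev.and self_mem_nhdsWithin).exists
  exact ⟨q, hμq, lintegral_exp_mul_chiSqSumLaw_ne_top hq⟩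

lemma lintegral_exp_div_chiSqSumLaw (hμ : 0 < μ) (hw : ∀ j ∈ s, w j ≤ μ) :
    ∫⁻ x, .ofReal (exp (1 / (2 * μ) * x)) ∂chiSqSumLaw s w =
      ENNReal.ofReal ((∏ j ∈ s, (μ - w j)) / μ ^ s.card) ^ (-(1 / 2) : ℝ) := by
  rw [lintegral_exp_mul_chiSqSumLaw, ← Finset.prod_const, ← Finset.prod_div_distrib,
    ENNReal.ofReal_prod_of_nonneg fun j hj => div_nonneg (sub_nonneg.2 (hw j hj)) hμ.le]
  congr! 3
  field_simp

lemma eventually_chiSqSumLaw_Ioi_le_of_lt {k : ι} (hk : k ∈ s) (hvk : 0 < v k)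
    (hv : ∀ j ∈ s, 0 ≤ v j) (hw : ∀ j ∈ s, w j < v k) :
    ∀ᶠ x in atTop, chiSqSumLaw s w (Ioi x) ≤ chiSqSumLaw s v (Ioi x) := by
  obtain ⟨q, hq, hfin⟩ := exists_lintegral_exp_mul_chiSqSumLaw_ne_top hvk hw
  have htail : HasExpTail (chiSqSumLaw {k} v) (1 / (2 * v k)) :=
    hasExpTail_chiSqSumLaw (Finset.singleton_nonempty k) hvk (by simp)
  filter_upwards [htail.eventually_measure_Ioi_le (by positivity) hq hfin] with x hx
  exact hx.trans (chiSqSumLaw_Ioi_mono (Finset.singleton_subset_iff.2 hk) hv x)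

lemma eventually_chiSqSumLaw_Ioi_le_of_prod_lt [DecidableEq ι] (hμ : 0 < μ) (hs : s.Nonempty)
    (hst : Disjoint s t) (hws : ∀ j ∈ s, w j = μ) (hvs : ∀ j ∈ s, v j = μ)
    (hwt0 : ∀ j ∈ t, 0 ≤ w j) (hwt : ∀ j ∈ t, w j < μ) (hvt : ∀ j ∈ t, v j ≤ μ)
    (hprod : ∏ j ∈ t, (μ - v j) < ∏ j ∈ t, (μ - w j)) :
    ∀ᶠ x in atTop, chiSqSumLaw (s ∪ t) w (Ioi x) ≤ chiSqSumLaw (s ∪ t) v (Ioi x) := by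
  obtain ⟨q, hq, hfin⟩ := exists_lintegral_exp_mul_chiSqSumLaw_ne_top hμ hwt
  have hq0 : 0 ≤ q := le_trans (by positivity) hq.le
  have hvw : chiSqSumLaw s v = chiSqSumLaw s w :=
    chiSqSumLaw_congr fun j hj => (hvs j hj).trans (hws j hj).symm
  have hmoment : ∫⁻ x, .ofReal (exp (1 / (2 * μ) * x)) ∂chiSqSumLaw t w <
      ∫⁻ x, .ofReal (exp (1 / (2 * μ) * x)) ∂chiSqSumLaw t v := by
    have hpos : 0 < ∏ j ∈ t, (μ - w j) := Finset.prod_pos fun j hj => sub_pos.2 (hwt j hj)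
    rw [lintegral_exp_div_chiSqSumLaw hμ fun j hj => (hwt j hj).le,
      lintegral_exp_div_chiSqSumLaw hμ hvt, ENNReal.rpow_neg, ENNReal.rpow_neg,
      ENNReal.inv_lt_inv]
    refine ENNReal.rpow_lt_rpow ?_ (by norm_num)
    rw [ENNReal.ofReal_lt_ofReal_iff (by positivity)]
    gcongr
  rw [chiSqSumLaw_union hst, chiSqSumLaw_union hst, hvw]
  exact (hasExpTail_chiSqSumLaw hs hμ hws).eventually_conv_Ioi_le hq hq0
    (ae_nonneg_chiSqSumLaw hwt0) hfin hmoment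

theorem IsSpreadOn.eventually_chiSqSumLaw_Ioi_le {c : ℝ} (h : IsSpreadOn s c w v)
    (hw : ∀ j ∈ s, 0 ≤ w j) (hv : ∀ j ∈ s, 0 ≤ v j) :
    ∀ᶠ x in atTop, chiSqSumLaw s w (Ioi x) ≤ chiSqSumLaw s v (Ioi x) := by
  classical
  by_cases hne : ∃ j ∈ s, w j ≠ v j
  swap
  · push Not at hne
    simp [chiSqSumLaw_congr hne]
  obtain ⟨j, hj, hcj, hjlt⟩ := h.exists_le_lt hne
  obtain ⟨k, hk, hmax⟩ := s.exists_max_image v ⟨j, hj⟩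
  have hc : c < v k := (hcj.trans_lt hjlt).trans_le (hmax j hj)
  have hvk : 0 < v k := ((hw j hj).trans_lt hjlt).trans_le (hmax j hj)
  have hle (i) (hi : i ∈ s) : w i ≤ v k := h.le_of_forall_le hc.le hmax hi
  have heq (i) (hi : i ∈ s) (hwi : w i = v k) : v i = v k :=
    h.eq_of_eq_upper hc hmax hi hwi
  by_cases htop : ∃ i ∈ s, w i = v k
  swap
  · push Not at htop
    exact eventually_chiSqSumLaw_Ioi_le_of_lt hk hvk hv fun i hi => (hle i hi).lt_of_ne (htop i hi)
  rw [← Finset.filter_union_filter_not_eq (fun i => w i = v k) s]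
  have hlt (i) (hi : i ∈ {i ∈ s | w i ≠ v k}) : w i < v k := by
    rw [Finset.mem_filter] at hi
    exact (hle i hi.1).lt_of_ne hi.2
  have hmax' (i) (hi : i ∈ {i ∈ s | w i ≠ v k}) : v i ≤ v k := hmax i (Finset.mem_filter.1 hi).1
  have hne' : ∃ i ∈ {i ∈ s | w i ≠ v k}, w i ≠ v i :=
    ⟨j, Finset.mem_filter.2 ⟨hj, (hjlt.trans_le (hmax j hj)).ne⟩, hjlt.ne⟩
  refine eventually_chiSqSumLaw_Ioi_le_of_prod_lt hvk (Finset.filter_nonempty_iff.2 htop)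
    (Finset.disjoint_filter_filter_not _ _ _) (fun i hi => (Finset.mem_filter.1 hi).2)
    (fun i hi => ?_) (fun i hi => hw i (Finset.mem_filter.1 hi).1) hlt hmax'
    ((h.filter_ne heq).prod_sub_lt_prod_sub hc hlt hmax' hne')
  rw [Finset.mem_filter] at hi
  exact heq i hi.1 hi.2

end ChiSquareSums

section Quantile

open MeasureTheory ProbabilityTheory Filter Set Topology

/-- The lower `q`-quantile of a probability law on the line. This is meaningful for `0 < q < 1`;
otherwise the infimum may be that of an empty or unbounded set, which is `0` in `ℝ`. -/
noncomputable def quantile (ν : Measure ℝ) (q : ℝ) : ℝ :=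
  sInf {t : ℝ | q ≤ ν.real (Iic t)}

variable {ν κ : Measure ℝ} [IsProbabilityMeasure ν] [IsProbabilityMeasure κ]

lemma real_Iic_eq_one_sub (ν : Measure ℝ) [IsProbabilityMeasure ν] (t : ℝ) :
    ν.real (Iic t) = 1 - ν.real (Ioi t) := by
  rw [← probReal_compl_eq_one_sub measurableSet_Ioi, compl_Ioi]

lemma nonempty_le_real_Iic (ν : Measure ℝ) [IsProbabilityMeasure ν] {q : ℝ} (hq : q < 1) :
    {t : ℝ | q ≤ ν.real (Iic t)}.Nonempty := by
  simp only [← cdf_eq_real]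
  obtain ⟨t, ht⟩ := ((tendsto_cdf_atTop ν).eventually_const_lt hq).exists
  exact ⟨t, ht.le⟩

lemma bddBelow_le_real_Iic (ν : Measure ℝ) [IsProbabilityMeasure ν] {q : ℝ} (hq : 0 < q) :
    BddBelow {t : ℝ | q ≤ ν.real (Iic t)} := by
  simp only [← cdf_eq_real]
  obtain ⟨t₀, ht₀⟩ := ((tendsto_cdf_atBot ν).eventually_lt_const hq).exists
  exact ⟨t₀, fun t ht => ((monotone_cdf ν).reflect_lt (ht₀.trans_le ht)).le⟩

lemma eventually_quantile_le (hle : ∀ᶠ t in atTop, κ (Ioi t) ≤ ν (Ioi t))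
    (hpos : ∀ t, ν (Ioi t) ≠ 0) :
    ∀ᶠ α in 𝓝[>] (0 : ℝ), quantile κ (1 - α) ≤ quantile ν (1 - α) := by
  obtain ⟨T, hT⟩ := eventually_atTop.1 hle
  have hposT : 0 < ν.real (Ioi T) := ENNReal.toReal_pos (hpos T) (measure_ne_top _ _)
  filter_upwards [Ioo_mem_nhdsGT (lt_min one_pos hposT)] with α ⟨hα0, hα⟩
  obtain ⟨hα1, hαT⟩ := lt_min_iff.1 hα
  refine csInf_le_csInf (bddBelow_le_real_Iic κ (sub_pos.2 hα1))
    (nonempty_le_real_Iic ν (sub_lt_self 1 hα0)) fun t (ht : 1 - α ≤ ν.real (Iic t)) => ?_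
  rw [real_Iic_eq_one_sub, sub_le_sub_iff_left] at ht
  have hTt : T ≤ t := by
    by_contra! hlt
    exact (ht.trans_lt hαT).not_ge (measureReal_mono (Ioi_subset_Ioi hlt.le))
  rw [mem_ofPred_eq, real_Iic_eq_one_sub, sub_le_sub_iff_left]
  exact (ENNReal.toReal_mono (measure_ne_top _ _) (hT t hTt)).trans ht

lemma IsMajorizingVector.eventually_critValue_le {n : ℕ} {up lo v w : Fin n → ℝ}
    (hv : IsMajorizingVector up lo (∑ j, w j) v) (hlo : 0 ≤ lo) (hw : Antitone w) (h1 : lo ≤ w)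
    (h2 : w ≤ up) : ∀ᶠ α in 𝓝[>] (0 : ℝ), critValue α w ≤ critValue α v := by
  have hw0 : 0 ≤ w := hlo.trans h1
  have hv0 : 0 ≤ v := hv.nonneg hlo (h1.trans h2)
  by_cases hne : ∃ k, 0 < v k
  · obtain ⟨k, hk⟩ := hne
    obtain ⟨c, hspread⟩ := hv.isSpreadOn hw h1 h2
    exact eventually_quantile_le (ν := chiSqSumLaw Finset.univ v) (κ := chiSqSumLaw Finset.univ w)
      (hspread.eventually_chiSqSumLaw_Ioi_le (fun j _ => hw0 j) fun j _ => hv0 j)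
      (chiSqSumLaw_Ioi_ne_zero (fun j _ => hv0 j) (Finset.mem_univ k) hk)
  · push Not at hne
    have hv_zero : v = 0 := le_antisymm hne hv0
    have hw_zero : w = 0 := by
      have hsum := hv.sum_eq
      rw [hv_zero] at hsum
      exact (Fintype.sum_eq_zero_iff_of_nonneg hw0).1 (by simpa using hsum.symm)
    rw [hv_zero, hw_zero]
    exact .of_forall fun _ => le_rfl

end Quantile

theorem lemma3 {n p m : ℕ} (hp : p < n)
    (Z : Matrix (Fin n) (Fin p) ℝ) (hZ : IsUnit (Z.transpose * Z).det)
    (X : Matrix (Fin n) (Fin m) ℝ)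
    (σ : Fin n → ℝ) (hσ : ∀ i, 0 ≤ σ i)
    (R : Finset (Fin m)) :
    (∀ S : Finset (Fin m), R ⊆ S → S ⊆ Finset.univ →
      ∃! v : Fin n → ℝ,
        IsMajorizingVector (nullWeights Z X σ Finset.univ) (nullWeights Z X σ R)
          (level Z X σ S) v) ∧
    ∃ α₀ : ℝ, 0 < α₀ ∧ α₀ < 1 ∧
      ∀ α : ℝ, 0 < α → α ≤ α₀ →
        ∀ S : Finset (Fin m), R ⊆ S → S ⊆ Finset.univ →
          ∀ v : Fin n → ℝ,
            IsMajorizingVector (nullWeights Z X σ Finset.univ) (nullWeights Z X σ R)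
              (level Z X σ S) v →
            critValue α (nullWeights Z X σ S) ≤ critValue α v := by
  have hlo_up : nullWeights Z X σ R ≤ nullWeights Z X σ Finset.univ :=
    nullWeights_mono Z X σ R.subset_univ
  have hex (S : Finset (Fin m)) (hRS : R ⊆ S) : ∃ v, IsMajorizingVector
      (nullWeights Z X σ Finset.univ) (nullWeights Z X σ R) (level Z X σ S) v :=
    exists_isMajorizingVector (Nat.zero_lt_of_lt hp) (nullWeights_antitone Z X σ _)
      (nullWeights_antitone Z X σ _) hlo_up (level_mono Z X σ hRS) (level_mono Z X σ S.subset_univ)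
  refine ⟨fun S hRS _ => ?_, ?_⟩
  · obtain ⟨v, hv⟩ := hex S hRS
    exact ⟨v, hv, fun v' hv' => hv'.unique hlo_up hv⟩
  have hev : ∀ᶠ α in nhdsWithin 0 (Set.Ioi 0), ∀ S : Finset (Fin m), R ⊆ S → ∀ v,
      IsMajorizingVector (nullWeights Z X σ Finset.univ) (nullWeights Z X σ R) (level Z X σ S) v →
        critValue α (nullWeights Z X σ S) ≤ critValue α v := by
    refine Filter.eventually_all.2 fun S => Filter.eventually_imp_distrib_left.2 fun hRS => ?_
    obtain ⟨v, hv⟩ := hex S hRS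
    filter_upwards [hv.eventually_critValue_le (nullWeights_nonneg Z X σ R)
      (nullWeights_antitone Z X σ S) (nullWeights_mono Z X σ hRS)
      (nullWeights_mono Z X σ S.subset_univ)] with α hα v' hv'
    rwa [hv'.unique hlo_up hv]
  obtain ⟨u, hu, hsub⟩ := mem_nhdsGT_iff_exists_Ioc_subset.1 hev
  exact ⟨min u (1 / 2), lt_min hu one_half_pos, (min_le_right _ _).trans_lt one_half_lt_one,
    fun α h0 h1 S hRS _ => hsub ⟨h0, h1.trans (min_le_left _ _)⟩ S hRS⟩
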